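/- Consider the two-player differential game $$\dot x=f(t,x,u)+g(t,x,v),\qquad t\in[0,T],\ x\in\mathbb R^n,\ u\in P,\ v\in Q,$$ with $T>0$, in which player $i$ wants to maximize $\sigma_i(x(T))$, $i=1,2$. Assume that $P$ and $Q$ are compact metric spaces, that $f,g,\sigma_1,\sigma_2$ are continuous, and that $f$ and $g$ are Lipschitz continuous in $x$ on every bounded set of $x$, uniformly in $t$ and in the control, and satisfy the sublinear growth conditions $\|f(t,x,u)\|\le A(1+\|x\|)$, $\|g(t,x,v)\|\le A(1+\|x\|)$. Let $\mathcal U$, $\mathcal V$ be the sets of measurable functions $[0,T]\to P$, $[0,T]\to Q$; for $u\in\mathcal U$, $v\in\mathcal V$ let $x(\cdot,t_*,x_*,u,v)$ be the solution on $[0,T]$ of $\dot x(t)=f(t,x(t),u(t))+g(t,x(t),v(t))$, $x(t_*)=x_*$. With closures taken in $C([0,T],\mathbb R^n)$, put $$\mathrm{Sol}^1(t_*,x_*;v_*)=\mathrm{cl}\{x(\cdot,t_*,x_*,u,v_*):u\in\mathcal U\},\quad \mathrm{Sol}^2(t_*,x_*;u_*)=\mathrm{cl}\{x(\cdot,t_*,x_*,u_*,v):v\in\mathcal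 V\},$$ $$\mathrm{Sol}(t_*,x_*)=\mathrm{cl}\{x(\cdot,t_*,x_*,u,v):u\in\mathcal U,\ v\in\mathcal V\},$$ where $u_*\in P$, $v_*\in Q$ are identified with constant controls. For $t\in[0,T]$ and $x,s\in\mathbb R^n$ let $\hat u(t,x,s)\in P$ be any maximizer of $u\mapsto\langle s,f(t,x,u)\rangle$ over $P$ and $\hat v(t,x,s)\in Q$ any maximizer of $v\mapsto\langle s,g(t,x,v)\rangle$ over $Q$, and set $$\mathcal H_i(t,x,s_1,s_2)=\langle s_i,\ f(t,x,\hat u(t,x,s_1))+g(t,x,\hat v(t,x,s_2))\rangle,\qquad i=1,2.$$ Let $(\varphi_1,\varphi_2)$ be a classical solution of the system of Hamilton--Jacobi equations $$\frac{\partial\varphi_i}{\partial t}+\mathcal H_i(t,x,\nabla\varphi_1,\nabla\varphi_2)=0,\qquad \varphi_i(T,x)=\sigma_i(x),\qquad i=1,2,$$ that is, $\varphi_1,\varphi_2$ are continuous on $[0,T]\times\mathbb R^n$, of class $C^1$ on $(0,T)\times\mathbb R^n$, satisfy the equations on $(0,T)\times\mathbb R^n$, and satisfy the terminal conditions. Then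 $(c_1,c_2)=(\varphi_1,\varphi_2)$ is a continuous function on $[0,T]\times\mathbb R^n$ that satisfies the following conditions. - (F1) $c_i(T,x)=\sigma_i(x)$ for all $x\in\mathbb R^n$, $i=1,2$. - (F2) For every $(t_*,x_*)\in[0,T]\times\mathbb R^n$ and $u\in P$ there is $y^2\in\mathrm{Sol}^2(t_*,x_*;u)$ such that $c_1(t,y^2(t))\le c_1(t_*,x_*)$ for all $t\in[t_*,T]$. - (F3) For every $(t_*,x_*)\in[0,T]\times\mathbb R^n$ and $v\in Q$ there is $y^1\in\mathrm{Sol}^1(t_*,x_*;v)$ such that $c_2(t,y^1(t))\le c_2(t_*,x_*)$ for all $t\in[t_*,T]$. - (F4) For every $(t_*,x_*)\in[0,T]\times\mathbb R^n$ there is $y^{(c)}\in\mathrm{Sol}(t_*,x_*)$ such that $c_i(t,y^{(c)}(t))=c_i(t_*,x_*)$ for all $t\in[t_*,T]$, $i=1,2$. -/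

import Mathlib

open Set MeasureTheory

/-- The phase space `ℝⁿ` with its Euclidean norm and inner product. -/
abbrev Phase (n : ℕ) : Type := EuclideanSpace ℝ (Fin n)

/-- A two-player nonzero-sum differential game with dynamics
`x' = f(t, x, u) + g(t, x, v)`, `t ∈ [0, T]`, `u ∈ P`, `v ∈ Q`, and terminal payoffs
`σ₁(x(T))`, `σ₂(x(T))`.  Only the values of `f` and `g` at times `t ∈ [0, T]` matter.
The Lipschitz condition in `x` is only asked on bounded sets (uniformly in time and control);
together with the sublinear growth it is implied by a global Lipschitz condition. -/
structure DiffGame (n : ℕ) (P Q : Type*) [TopologicalSpace P] [TopologicalSpace Q] where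
  T : ℝ
  T_pos : 0 < T
  f : ℝ → Phase n → P → Phase n
  g : ℝ → Phase n → Q → Phase n
  σ₁ : Phase n → ℝ
  σ₂ : Phase n → ℝ
  continuousOn_f :
    ContinuousOn (fun z : ℝ × Phase n × P => f z.1 z.2.1 z.2.2) (Icc 0 T ×ˢ univ)
  continuousOn_g :
    ContinuousOn (fun z : ℝ × Phase n × Q => g z.1 z.2.1 z.2.2) (Icc 0 T ×ˢ univ)
  lipschitz_f : ∀ R : ℝ, ∃ L : ℝ, ∀ t ∈ Icc 0 T, ∀ x y : Phase n, ‖x‖ ≤ R → ‖y‖ ≤ R →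
    ∀ u : P, ‖f t x u - f t y u‖ ≤ L * ‖x - y‖
  lipschitz_g : ∀ R : ℝ, ∃ L : ℝ, ∀ t ∈ Icc 0 T, ∀ x y : Phase n, ‖x‖ ≤ R → ‖y‖ ≤ R →
    ∀ v : Q, ‖g t x v - g t y v‖ ≤ L * ‖x - y‖
  growth_f : ∃ A : ℝ, ∀ t ∈ Icc 0 T, ∀ (x : Phase n) (u : P), ‖f t x u‖ ≤ A * (1 + ‖x‖)
  growth_g : ∃ A : ℝ, ∀ t ∈ Icc 0 T, ∀ (x : Phase n) (v : Q), ‖g t x v‖ ≤ A * (1 + ‖x‖)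
  continuous_σ₁ : Continuous σ₁
  continuous_σ₂ : Continuous σ₂

namespace DiffGame

variable {n : ℕ} {P Q : Type*} [TopologicalSpace P] [TopologicalSpace Q]

/-- `x` is the solution `x(·, t₀, x₀, u, v)` on `[0, T]` of
`x' = f(t, x, u(t)) + g(t, x, v(t))`, `x(t₀) = x₀` (in the sense of Carathéodory, that is, of the
equivalent integral equation).  Controls are functions on `ℝ` of which only the restriction
to `[0, T]` is used. -/
def IsMotion (G : DiffGame n P Q) (t₀ : ℝ) (x₀ : Phase n) (u : ℝ → P) (v : ℝ → Q)
    (x : C(Icc 0 G.T, Phase n)) : Prop :=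
  ∀ t : Icc 0 G.T, x t = x₀ + ∫ τ in t₀..t,
    (G.f τ (IccExtend G.T_pos.le x τ) (u τ) + G.g τ (IccExtend G.T_pos.le x τ) (v τ))

/-- `Sol¹(t₀, x₀; v)`: the uniform closure of the motions for the constant control `v` of
player II and all measurable controls of player I. -/
def Sol₁ [MeasurableSpace P] (G : DiffGame n P Q) (t₀ : ℝ) (x₀ : Phase n) (v : Q) :
    Set C(Icc 0 G.T, Phase n) :=
  closure {x | ∃ u : ℝ → P, Measurable u ∧ G.IsMotion t₀ x₀ u (fun _ => v) x}

/-- `Sol²(t₀, x₀; u)`: the uniform closure of the motions for the constant control `u` of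
player I and all measurable controls of player II. -/
def Sol₂ [MeasurableSpace Q] (G : DiffGame n P Q) (t₀ : ℝ) (x₀ : Phase n) (u : P) :
    Set C(Icc 0 G.T, Phase n) :=
  closure {x | ∃ v : ℝ → Q, Measurable v ∧ G.IsMotion t₀ x₀ (fun _ => u) v x}

/-- `Sol(t₀, x₀)`: the uniform closure of the motions for all measurable controls. -/
def Sol [MeasurableSpace P] [MeasurableSpace Q] (G : DiffGame n P Q) (t₀ : ℝ) (x₀ : Phase n) :
    Set C(Icc 0 G.T, Phase n) :=
  closure {x | ∃ (u : ℝ → P) (v : ℝ → Q), Measurable u ∧ Measurable v ∧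
    G.IsMotion t₀ x₀ u v x}

/-- `(c₁, c₂) : [0, T] × ℝⁿ → ℝ²` is continuous and satisfies the conditions (F1)–(F4). -/
structure IsValueFunction [MeasurableSpace P] [MeasurableSpace Q] (G : DiffGame n P Q)
    (c₁ c₂ : ℝ → Phase n → ℝ) : Prop where
  continuousOn₁ : ContinuousOn (fun z : ℝ × Phase n => c₁ z.1 z.2) (Icc 0 G.T ×ˢ univ)
  continuousOn₂ : ContinuousOn (fun z : ℝ × Phase n => c₂ z.1 z.2) (Icc 0 G.T ×ˢ univ)
  F1 : ∀ x, c₁ G.T x = G.σ₁ x ∧ c₂ G.T x = G.σ₂ x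
  F2 : ∀ t₀ ∈ Icc 0 G.T, ∀ (x₀ : Phase n) (u : P), ∃ y ∈ G.Sol₂ t₀ x₀ u,
    ∀ t : Icc 0 G.T, t₀ ≤ t → c₁ t (y t) ≤ c₁ t₀ x₀
  F3 : ∀ t₀ ∈ Icc 0 G.T, ∀ (x₀ : Phase n) (v : Q), ∃ y ∈ G.Sol₁ t₀ x₀ v,
    ∀ t : Icc 0 G.T, t₀ ≤ t → c₂ t (y t) ≤ c₂ t₀ x₀
  F4 : ∀ t₀ ∈ Icc 0 G.T, ∀ x₀ : Phase n, ∃ y ∈ G.Sol t₀ x₀,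
    ∀ t : Icc 0 G.T, t₀ ≤ t → c₁ t (y t) = c₁ t₀ x₀ ∧ c₂ t (y t) = c₂ t₀ x₀

/-- `û(t, x, s)` maximizes `⟨s, f(t, x, u)⟩` over `u ∈ P`. -/
def IsMaximizer₁ (G : DiffGame n P Q) (uhat : ℝ → Phase n → Phase n → P) : Prop :=
  ∀ t ∈ Icc 0 G.T, ∀ (x s : Phase n) (u : P),
    inner ℝ s (G.f t x u) ≤ inner ℝ s (G.f t x (uhat t x s))

/-- `v̂(t, x, s)` maximizes `⟨s, g(t, x, v)⟩` over `v ∈ Q`. -/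
def IsMaximizer₂ (G : DiffGame n P Q) (vhat : ℝ → Phase n → Phase n → Q) : Prop :=
  ∀ t ∈ Icc 0 G.T, ∀ (x s : Phase n) (v : Q),
    inner ℝ s (G.g t x v) ≤ inner ℝ s (G.g t x (vhat t x s))

/-- `ℋ₁(t, x, s₁, s₂) = ⟨s₁, f(t, x, û(t, x, s₁)) + g(t, x, v̂(t, x, s₂))⟩`. -/
noncomputable def Ham₁ (G : DiffGame n P Q) (uhat : ℝ → Phase n → Phase n → P)
    (vhat : ℝ → Phase n → Phase n → Q) (t : ℝ) (x s₁ s₂ : Phase n) : ℝ :=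
  inner ℝ s₁ (G.f t x (uhat t x s₁) + G.g t x (vhat t x s₂))

/-- `ℋ₂(t, x, s₁, s₂) = ⟨s₂, f(t, x, û(t, x, s₁)) + g(t, x, v̂(t, x, s₂))⟩`. -/
noncomputable def Ham₂ (G : DiffGame n P Q) (uhat : ℝ → Phase n → Phase n → P)
    (vhat : ℝ → Phase n → Phase n → Q) (t : ℝ) (x s₁ s₂ : Phase n) : ℝ :=
  inner ℝ s₂ (G.f t x (uhat t x s₁) + G.g t x (vhat t x s₂))

/-- `(φ₁, φ₂)` is a classical solution of the system `∂φᵢ/∂t + ℋᵢ(t, x, ∇φ₁, ∇φ₂) = 0`,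
`φᵢ(T, x) = σᵢ(x)`, `i = 1, 2`: it is continuous on `[0, T] × ℝⁿ`, of class `C¹` on
`(0, T) × ℝⁿ`, and satisfies the equations there and the terminal conditions. -/
structure IsClassicalSolution (G : DiffGame n P Q) (uhat : ℝ → Phase n → Phase n → P)
    (vhat : ℝ → Phase n → Phase n → Q) (φ₁ φ₂ : ℝ → Phase n → ℝ) : Prop where
  continuousOn₁ : ContinuousOn (fun z : ℝ × Phase n => φ₁ z.1 z.2) (Icc 0 G.T ×ˢ univ)
  continuousOn₂ : ContinuousOn (fun z : ℝ × Phase n => φ₂ z.1 z.2) (Icc 0 G.T ×ˢ univ)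
  contDiffOn₁ : ContDiffOn ℝ 1 (fun z : ℝ × Phase n => φ₁ z.1 z.2) (Ioo 0 G.T ×ˢ univ)
  contDiffOn₂ : ContDiffOn ℝ 1 (fun z : ℝ × Phase n => φ₂ z.1 z.2) (Ioo 0 G.T ×ˢ univ)
  equation₁ : ∀ t ∈ Ioo 0 G.T, ∀ x : Phase n,
    deriv (fun s => φ₁ s x) t + G.Ham₁ uhat vhat t x (gradient (φ₁ t) x) (gradient (φ₂ t) x) = 0
  equation₂ : ∀ t ∈ Ioo 0 G.T, ∀ x : Phase n,
    deriv (fun s => φ₂ s x) t + G.Ham₂ uhat vhat t x (gradient (φ₁ t) x) (gradient (φ₂ t) x) = 0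
  terminal₁ : ∀ x, φ₁ G.T x = G.σ₁ x
  terminal₂ : ∀ x, φ₂ G.T x = G.σ₂ x

end DiffGame

/-! Fix `u` and let player II use `v̂(t, x, ∇φ₂)`. Since `û(t, x, ∇φ₁)` maximizes `⟨∇φ₁, f⟩`, the
derivative of `φ₁` along the resulting velocity is at most `∂φ₁/∂t + ℋ₁ = 0`. This is the
infinitesimal form of (F2), and (F3) is symmetric. If both players use the maximizers, the
derivatives of `φ₁` and `φ₂` vanish, which gives (F4). All three cases have one form: a finite
family `ψ` such that at each interior point some control makes every component nonincreasing
(`IsControlLyapunov`). For (F4) the family is `φ₁, -φ₁, φ₂, -φ₂`.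

The maximizers need be neither continuous nor measurable, so the closed-loop equation may have no
solution. Instead the control is sampled and frozen over short time steps. By compactness a control
that is good at a point stays good up to `ε` nearby, uniformly (`exists_uniform_control`), so
piecewise constant controls keep `ψ` below its initial value up to `ε` (`exists_trajectory_Icc`,
`exists_trajectory_le`). Trajectories from one point are uniformly bounded and equi-Lipschitz;
Arzelà–Ascoli lets `ε → 0` and gives a point of the closure (`exists_mem_closure`). -/

/-! ### A priori bounds under sublinear growth -/

section AprioriBound

variable {E : Type*} [NormedAddCommGroup E]

/-- A logarithmic size of a vector, which is Lipschitz along solutions of equations with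
sublinear growth. -/
noncomputable def logSize (x : E) : ℝ := Real.log (1 + ‖x‖ ^ 2)

lemma norm_le_of_logSize_le {x y : E} {c : ℝ} (h : logSize x ≤ logSize y + c) :
    ‖x‖ ≤ (1 + ‖y‖ ^ 2) * Real.exp c := by
  have hx : (0 : ℝ) < 1 + ‖x‖ ^ 2 := by positivity
  have hy : (0 : ℝ) < 1 + ‖y‖ ^ 2 := by positivity
  have h1 := Real.exp_le_exp.2 h
  rw [Real.exp_add, logSize, logSize, Real.exp_log hx, Real.exp_log hy] at h1
  nlinarith [sq_nonneg (‖x‖ - 1)]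

/-- The derivative of `log (1 + ‖x‖²)` is at most `2A‖x‖(1 + ‖x‖) / (1 + ‖x‖²) ≤ 4A`. Unlike the
norm itself, this size is differentiable at the origin. -/
lemma abs_logSize_sub_le [InnerProductSpace ℝ E] {x x' : ℝ → E} {a b A : ℝ} (hA : 0 ≤ A)
    (hx : ∀ t ∈ Icc a b, HasDerivWithinAt x (x' t) (Icc a b) t)
    (hx' : ∀ t ∈ Icc a b, ‖x' t‖ ≤ A * (1 + ‖x t‖)) {s t : ℝ}
    (hs : s ∈ Icc a b) (ht : t ∈ Icc a b) :
    |logSize (x t) - logSize (x s)| ≤ 4 * A * |t - s| := by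
  have hderiv : ∀ τ ∈ Icc a b, HasDerivWithinAt (fun τ => logSize (x τ))
      (2 * inner ℝ (x τ) (x' τ) / (1 + ‖x τ‖ ^ 2)) (Icc a b) τ := fun τ hτ =>
    (((hx τ hτ).norm_sq).const_add 1).log (by positivity)
  have := Convex.norm_image_sub_le_of_norm_hasDerivWithin_le hderiv (C := 4 * A) ?_
    (convex_Icc a b) hs ht
  · simpa using this
  intro τ hτ
  have hpos : (0 : ℝ) < 1 + ‖x τ‖ ^ 2 := by positivity
  rw [Real.norm_eq_abs, abs_div, abs_of_pos hpos, div_le_iff₀ hpos, abs_mul, abs_two]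
  have h1 := abs_real_inner_le_norm (x τ) (x' τ)
  have h2 := mul_le_mul_of_nonneg_left (hx' τ hτ) (norm_nonneg (x τ))
  nlinarith [mul_nonneg hA (sq_nonneg (‖x τ‖ - 1)), mul_nonneg hA (sq_nonneg ‖x τ‖)]

end AprioriBound

/-! ### Controlled fields and global solutions for constant controls -/

/-- A controlled vector field on `[0, T]` that is continuous, locally Lipschitz in the state
uniformly in time and control, and of sublinear growth with constant `A`. -/
structure IsControlField {E W : Type*} [NormedAddCommGroup E] [TopologicalSpace W]
    (T A : ℝ) (F : ℝ → E → W → E) : Prop where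
  T_pos : 0 < T
  A_nonneg : 0 ≤ A
  continuousOn : ContinuousOn (fun z : ℝ × E × W => F z.1 z.2.1 z.2.2) (Icc 0 T ×ˢ univ)
  lipschitz : ∀ R : ℝ, ∃ L : ℝ, ∀ t ∈ Icc 0 T, ∀ x y : E, ‖x‖ ≤ R → ‖y‖ ≤ R →
    ∀ w : W, ‖F t x w - F t y w‖ ≤ L * ‖x - y‖
  growth : ∀ t ∈ Icc 0 T, ∀ (x : E) (w : W), ‖F t x w‖ ≤ A * (1 + ‖x‖)

/-- A cutoff function, equal to `1` on the ball of radius `R` and to `0` off the ball of radius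
`R + 1`. -/
noncomputable def ballCutoff {E : Type*} [NormedAddCommGroup E] (R : ℝ) (x : E) : ℝ :=
  max 0 (min 1 (R + 1 - ‖x‖))

section Cutoff

variable {E : Type*} [NormedAddCommGroup E] (R : ℝ) (x y : E)

lemma ballCutoff_nonneg : 0 ≤ ballCutoff R x := le_max_left _ _

lemma ballCutoff_le_one : ballCutoff R x ≤ 1 := max_le zero_le_one (min_le_left _ _)

lemma ballCutoff_eq_one {R : ℝ} {x : E} (h : ‖x‖ ≤ R) : ballCutoff R x = 1 := by
  rw [ballCutoff, min_eq_left (by linarith), max_eq_right zero_le_one]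

lemma ballCutoff_eq_zero {R : ℝ} {x : E} (h : R + 1 ≤ ‖x‖) : ballCutoff R x = 0 :=
  max_eq_left ((min_le_right _ _).trans (by linarith))

lemma abs_ballCutoff_sub_le : |ballCutoff R x - ballCutoff R y| ≤ ‖x - y‖ := by
  have h1 : |ballCutoff R x - ballCutoff R y| ≤
      |min 1 (R + 1 - ‖x‖) - min 1 (R + 1 - ‖y‖)| := by
    rw [ballCutoff, ballCutoff, max_comm 0, max_comm 0]
    exact abs_max_sub_max_le_abs _ _ 0
  have h2 : |min 1 (R + 1 - ‖x‖) - min 1 (R + 1 - ‖y‖)| ≤ |‖x‖ - ‖y‖| := by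
    rw [abs_le]
    have h3 := le_abs_self (‖x‖ - ‖y‖)
    have h4 := neg_abs_le (‖x‖ - ‖y‖)
    have h5 := abs_nonneg (‖x‖ - ‖y‖)
    constructor <;> rcases min_cases 1 (R + 1 - ‖x‖) with h | h <;>
      rcases min_cases 1 (R + 1 - ‖y‖) with h' | h' <;> linarith [h.1, h.2, h'.1, h'.2]
  exact (h1.trans h2).trans (abs_norm_sub_norm_le x y)

end Cutoff

namespace IsControlField

variable {E W : Type*} [NormedAddCommGroup E] [TopologicalSpace W] {T A : ℝ} {F : ℝ → E → W → E}

lemma continuousOn_comp (hF : IsControlField T A F) {S : Type*} [TopologicalSpace S] {s : Set S}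
    {τ : S → ℝ} {x : S → E} {w : S → W} (hτ : ContinuousOn τ s) (hx : ContinuousOn x s)
    (hw : ContinuousOn w s) (hmem : ∀ p ∈ s, τ p ∈ Icc 0 T) :
    ContinuousOn (fun p => F (τ p) (x p) (w p)) s :=
  hF.continuousOn.comp (hτ.prodMk (hx.prodMk hw)) fun p hp => ⟨hmem p hp, mem_univ _⟩

/-- For a constant control there is a global solution of the initial value problem. -/
theorem exists_solution [InnerProductSpace ℝ E] [CompleteSpace E] (hF : IsControlField T A F)
    {t₀ : ℝ} (ht₀ : t₀ ∈ Icc 0 T) (x₀ : E) (w : W) :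
    ∃ x : ℝ → E, x t₀ = x₀ ∧
      (∀ t ∈ Icc 0 T, HasDerivWithinAt x (F t (x t) w) (Icc 0 T) t) ∧
      ∀ t ∈ Icc 0 T, logSize (x t) ≤ logSize x₀ + 4 * A * |t - t₀| := by
  have hA := hF.A_nonneg
  have hT := hF.T_pos
  set R : ℝ := (1 + ‖x₀‖ ^ 2) * Real.exp (4 * A * T) with hR
  have hR0 : 0 ≤ R := by positivity
  -- The truncated field is bounded, so Picard–Lindelöf applies on all of `[0, T]`. Truncation
  -- preserves the growth bound, hence the logarithmic estimate keeps the solution in the ball of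
  -- radius `R`, where nothing was cut off.
  set G : ℝ → E → E := fun t x => ballCutoff R x • F t x w with hG
  have hnG : ∀ t x, ‖G t x‖ = ballCutoff R x * ‖F t x w‖ := fun t x => by
    rw [hG, norm_smul, Real.norm_of_nonneg (ballCutoff_nonneg R x)]
  have hGF : ∀ t x, ‖G t x‖ ≤ ‖F t x w‖ := fun t x => by
    rw [hnG]
    exact mul_le_of_le_one_left (norm_nonneg _) (ballCutoff_le_one R x)
  set M : ℝ := A * (1 + (R + 1)) with hM
  have hM0 : 0 ≤ M := by positivity
  have hGM : ∀ t ∈ Icc 0 T, ∀ x, ‖G t x‖ ≤ M := by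
    intro t ht x
    rcases le_total ‖x‖ (R + 1) with h | h
    · exact ((hGF t x).trans (hF.growth t ht x w)).trans
        (mul_le_mul_of_nonneg_left (by linarith) hA)
    · rw [hnG, ballCutoff_eq_zero h, zero_mul]
      exact hM0
  -- At speed at most `M` the ball of radius `M * T` about `x₀` cannot be left within time `T`.
  set a : ℝ := M * T with ha
  have ha0 : 0 ≤ a := by positivity
  obtain ⟨L, hL⟩ := hF.lipschitz (‖x₀‖ + a)
  set B : ℝ := A * (1 + (‖x₀‖ + a)) with hB
  have hB0 : 0 ≤ B := by positivity
  have hball : ∀ x ∈ Metric.closedBall x₀ a, ‖x‖ ≤ ‖x₀‖ + a := fun x hx => by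
    have h1 := norm_sub_norm_le x x₀
    rw [mem_closedBall_iff_norm] at hx
    linarith
  have hPL : IsPicardLindelof G (⟨t₀, ht₀⟩ : Icc 0 T) x₀ ⟨a, ha0⟩ 0 ⟨M, hM0⟩
      (⟨B, hB0⟩ + L.toNNReal) := by
    refine ⟨fun t ht => ?_, fun x _ => ?_, fun t ht x _ => hGM t ht x, ?_⟩
    · refine LipschitzOnWith.of_dist_le_mul fun x hx y hy => ?_
      have hx' := hball x hx
      have hy' := hball y hy
      rw [dist_eq_norm, dist_eq_norm, show G t x - G t y =
        ballCutoff R x • (F t x w - F t y w) + (ballCutoff R x - ballCutoff R y) • F t y w by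
          simp only [hG, smul_sub, sub_smul]; abel]
      refine (norm_add_le _ _).trans ?_
      rw [norm_smul, norm_smul, Real.norm_of_nonneg (ballCutoff_nonneg R x), Real.norm_eq_abs]
      have h1 : ‖F t x w - F t y w‖ ≤ (L.toNNReal : ℝ) * ‖x - y‖ :=
        (hL t ht x y hx' hy' w).trans (by gcongr; exact Real.le_coe_toNNReal L)
      have h2 : ‖F t y w‖ ≤ B := (hF.growth t ht y w).trans
        (mul_le_mul_of_nonneg_left (by linarith) hA)
      have h3 := abs_ballCutoff_sub_le R x y
      have h4 := mul_le_mul h3 h2 (norm_nonneg _) (norm_nonneg _)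
      have h5 := mul_le_of_le_one_left (norm_nonneg (F t x w - F t y w)) (ballCutoff_le_one R x)
      calc _ ≤ (L.toNNReal : ℝ) * ‖x - y‖ + ‖x - y‖ * B := add_le_add (h5.trans h1) h4
        _ = (B + (L.toNNReal : ℝ)) * ‖x - y‖ := by ring
    · exact (hF.continuousOn_comp continuousOn_id continuousOn_const continuousOn_const
        fun t ht => ht).const_smul (ballCutoff R x)
    · change M * max (T - t₀) (t₀ - 0) ≤ a - 0
      rw [sub_zero, sub_zero, ha]
      gcongr
      exact max_le (by linarith [ht₀.1]) ht₀.2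
  obtain ⟨x, hx0, hx⟩ := hPL.exists_eq_forall_mem_Icc_hasDerivWithinAt₀
  have hx0 : x t₀ = x₀ := hx0
  have hsize : ∀ t ∈ Icc 0 T, logSize (x t) ≤ logSize x₀ + 4 * A * |t - t₀| := by
    intro t ht
    have := abs_logSize_sub_le hA hx
      (fun s hs => (hGF s (x s)).trans (hF.growth s hs (x s) w)) ht₀ ht
    rw [hx0] at this
    linarith [le_abs_self (logSize (x t) - logSize x₀)]
  refine ⟨x, hx0, fun t ht => ?_, hsize⟩
  have hxR : ‖x t‖ ≤ R := by
    refine norm_le_of_logSize_le ((hsize t ht).trans ?_)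
    gcongr
    exact abs_sub_le_of_nonneg_of_le ht.1 ht.2 ht₀.1 ht₀.2
  simpa only [hG, ballCutoff_eq_one hxR, one_smul] using hx t ht

end IsControlField

/-! ### Trajectories for measurable controls -/

/-- `x` is a solution on `[0, T]` of `x' = F(t, x, w(t))`, `x(t₀) = x₀`, with measurable control
`w`, together with an a priori bound. -/
structure IsTrajectory {E W : Type*} [NormedAddCommGroup E] [NormedSpace ℝ E] [MeasurableSpace W]
    (T A : ℝ) (F : ℝ → E → W → E) (t₀ : ℝ) (x₀ : E) (w : ℝ → W) (x : ℝ → E) : Prop where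
  measurable : Measurable w
  continuousOn : ContinuousOn x (Icc 0 T)
  integrableOn : IntegrableOn (fun τ => F τ (x τ) (w τ)) (Icc 0 T)
  eq_integral : ∀ t ∈ Icc 0 T, x t = x₀ + ∫ τ in t₀..t, F τ (x τ) (w τ)
  logSize_le : ∀ t ∈ Icc 0 T, logSize (x t) ≤ logSize x₀ + 4 * A * |t - t₀|
  growth : ∀ t ∈ Icc 0 T, ‖F t (x t) (w t)‖ ≤ A * (1 + ‖x t‖)

/-- A bound for the trajectories that start at `x₀`. -/
noncomputable def trajectoryRadius {E : Type*} [NormedAddCommGroup E] (T A : ℝ) (x₀ : E) : ℝ :=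
  (1 + ‖x₀‖ ^ 2) * Real.exp (4 * A * T)

namespace IsTrajectory

variable {E W : Type*} [NormedAddCommGroup E] [NormedSpace ℝ E] [MeasurableSpace W]
  {T A : ℝ} {F : ℝ → E → W → E} {t₀ t₁ : ℝ} {x₀ : E} {w w' : ℝ → W} {x z : ℝ → E}

lemma intervalIntegrable (h : IsTrajectory T A F t₀ x₀ w x) {a b : ℝ} (ha : a ∈ Icc 0 T)
    (hb : b ∈ Icc 0 T) : IntervalIntegrable (fun τ => F τ (x τ) (w τ)) volume a b :=
  (h.integrableOn.mono_set (uIcc_subset_Icc ha hb)).intervalIntegrable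

lemma apply_start (h : IsTrajectory T A F t₀ x₀ w x) (ht₀ : t₀ ∈ Icc 0 T) : x t₀ = x₀ := by
  simpa using h.eq_integral t₀ ht₀

lemma norm_le (h : IsTrajectory T A F t₀ x₀ w x) (hA : 0 ≤ A) (ht₀ : t₀ ∈ Icc 0 T) {t : ℝ}
    (ht : t ∈ Icc 0 T) : ‖x t‖ ≤ trajectoryRadius T A x₀ := by
  refine norm_le_of_logSize_le ((h.logSize_le t ht).trans ?_)
  gcongr
  exact abs_sub_le_of_nonneg_of_le ht.1 ht.2 ht₀.1 ht₀.2

/-- The speed bound depends on `T`, `A` and `x₀` but not on the control; it fixes the sampling step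
and later gives equicontinuity. -/
lemma norm_sub_le (h : IsTrajectory T A F t₀ x₀ w x) (hA : 0 ≤ A) (ht₀ : t₀ ∈ Icc 0 T) {s t : ℝ}
    (hs : s ∈ Icc 0 T) (ht : t ∈ Icc 0 T) :
    ‖x t - x s‖ ≤ A * (1 + trajectoryRadius T A x₀) * |t - s| := by
  have h1 : x t - x s = ∫ τ in s..t, F τ (x τ) (w τ) := by
    rw [h.eq_integral t ht, h.eq_integral s hs, add_sub_add_left_eq_sub,
      intervalIntegral.integral_interval_sub_left (h.intervalIntegrable ht₀ ht)
        (h.intervalIntegrable ht₀ hs)]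
  rw [h1]
  refine intervalIntegral.norm_integral_le_of_norm_le_const fun τ hτ => ?_
  have hτ' : τ ∈ Icc 0 T := uIcc_subset_Icc hs ht (uIoc_subset_uIcc hτ)
  refine (h.growth τ hτ').trans ?_
  have := h.norm_le hA ht₀ hτ'
  gcongr

/-- Two trajectories can be concatenated. -/
theorem concat (h : IsTrajectory T A F t₀ x₀ w x) (h' : IsTrajectory T A F t₁ (x t₁) w' z)
    (ht₀ : t₀ ∈ Icc 0 T) (ht₁ : t₁ ∈ Icc t₀ T) :
    IsTrajectory T A F t₀ x₀ (fun τ => if τ ≤ t₁ then w τ else w' τ)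
      (fun τ => if τ ≤ t₁ then x τ else z τ) := by
  have ht₁' : t₁ ∈ Icc 0 T := ⟨ht₀.1.trans ht₁.1, ht₁.2⟩
  have hz : z t₁ = x t₁ := h'.apply_start ht₁'
  have hint : (fun τ => F τ (if τ ≤ t₁ then x τ else z τ) (if τ ≤ t₁ then w τ else w' τ)) =
      fun τ => if τ ≤ t₁ then F τ (x τ) (w τ) else F τ (z τ) (w' τ) := by
    ext1 τ
    split_ifs <;> rfl
  have hI : IntegrableOn
      (fun τ => if τ ≤ t₁ then F τ (x τ) (w τ) else F τ (z τ) (w' τ)) (Icc 0 T) :=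
    Integrable.piecewise (s := Iic t₁) measurableSet_Iic h.integrableOn.integrableOn
      h'.integrableOn.integrableOn
  refine ⟨Measurable.ite measurableSet_Iic h.measurable h'.measurable, ?_, ?_, ?_, ?_, ?_⟩
  · refine ContinuousOn.if ?_ (h.continuousOn.mono inter_subset_left)
      (h'.continuousOn.mono inter_subset_left)
    rintro τ ⟨-, hτ⟩
    have : τ = t₁ := by simpa using (frontier_Iic_subset t₁ hτ)
    rw [this, hz]
  · rwa [hint]
  · intro t ht
    rw [hint]
    have hleft : ∀ s ∈ Icc 0 T, s ≤ t₁ → ∫ τ in t₀..s,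
        (if τ ≤ t₁ then F τ (x τ) (w τ) else F τ (z τ) (w' τ)) =
        ∫ τ in t₀..s, F τ (x τ) (w τ) := by
      intro s _ hs
      refine intervalIntegral.integral_congr fun τ hτ => if_pos ?_
      exact hτ.2.trans (max_le ht₁.1 hs)
    split_ifs with htt
    · rw [hleft t ht htt, h.eq_integral t ht]
    · rw [← intervalIntegral.integral_add_adjacent_intervals (b := t₁)
        (hI.mono_set (uIcc_subset_Icc ht₀ ht₁')).intervalIntegrable
        (hI.mono_set (uIcc_subset_Icc ht₁' ht)).intervalIntegrable,
        hleft t₁ ht₁' le_rfl, ← add_assoc, ← h.eq_integral t₁ ht₁', h'.eq_integral t ht]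
      congr 1
      -- The integrands may differ at `τ = t₁`, which the half-open interval excludes.
      refine intervalIntegral.integral_congr_ae (Filter.Eventually.of_forall fun τ hτ => ?_)
      rw [uIoc_of_le (not_le.1 htt).le] at hτ
      exact (if_neg (not_le.2 hτ.1)).symm
  · intro t ht
    split_ifs with htt
    · exact h.logSize_le t ht
    · have h1 := h'.logSize_le t ht
      have h2 := h.logSize_le t₁ ht₁'
      -- As `t₀ ≤ t₁ ≤ t`, the two logarithmic bounds add up exactly, so the bound does not
      -- deteriorate with the number of pieces.
      rw [abs_of_nonneg (by linarith [ht₁.1])] at h1 h2 ⊢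
      linarith
  · intro t ht
    split_ifs with htt
    · exact h.growth t ht
    · exact h'.growth t ht

end IsTrajectory

namespace IsControlField

variable {E W : Type*} [NormedAddCommGroup E] [InnerProductSpace ℝ E] [CompleteSpace E]
  [TopologicalSpace W] [MeasurableSpace W] {T A : ℝ} {F : ℝ → E → W → E}

/-- Constant controls generate differentiable trajectories. -/
theorem exists_trajectory_const (hF : IsControlField T A F) {t₀ : ℝ} (ht₀ : t₀ ∈ Icc 0 T)
    (x₀ : E) (w : W) :
    ∃ x : ℝ → E, IsTrajectory T A F t₀ x₀ (fun _ => w) x ∧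
      ∀ t ∈ Icc 0 T, HasDerivWithinAt x (F t (x t) w) (Icc 0 T) t := by
  obtain ⟨x, hx0, hx, hsize⟩ := hF.exists_solution ht₀ x₀ w
  have hc : ContinuousOn x (Icc 0 T) := fun t ht => (hx t ht).continuousWithinAt
  have hFc : ContinuousOn (fun τ => F τ (x τ) w) (Icc 0 T) :=
    hF.continuousOn_comp continuousOn_id hc continuousOn_const fun t ht => ht
  refine ⟨x, ⟨measurable_const, hc, hFc.integrableOn_compact isCompact_Icc, fun t ht => ?_,
    hsize, fun t ht => hF.growth t ht _ _⟩, hx⟩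
  have hsub : uIcc t₀ t ⊆ Icc 0 T := uIcc_subset_Icc ht₀ ht
  rw [intervalIntegral.integral_eq_sub_of_hasDeriv_right (hc.mono hsub) (fun τ hτ => ?_)
    (hFc.mono hsub).intervalIntegrable, hx0, add_sub_cancel]
  have hτ' : τ ∈ Ioo 0 T :=
    ⟨(le_min ht₀.1 ht.1).trans_lt hτ.1, hτ.2.trans_le (max_le ht₀.2 ht.2)⟩
  exact ((hx τ (Ioo_subset_Icc_self hτ')).hasDerivAt (Icc_mem_nhds hτ'.1 hτ'.2)).hasDerivWithinAt

end IsControlField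

/-! ### Steering with sampled controls -/

/-- The components of `ψ` are continuous on `[0, T] × E`, of class `C¹` inside, and at each point
some control makes all of them nonincreasing along the control field `F`. -/
structure IsControlLyapunov {E W ι : Type*} [NormedAddCommGroup E] [NormedSpace ℝ E] [Fintype ι]
    (T : ℝ) (F : ℝ → E → W → E) (ψ : ℝ × E → ι → ℝ) : Prop where
  continuousOn : ContinuousOn ψ (Icc 0 T ×ˢ univ)
  contDiffOn : ContDiffOn ℝ 1 ψ (Ioo 0 T ×ˢ univ)
  exists_le : ∀ t ∈ Ioo 0 T, ∀ x, ∃ w, ∀ i, fderiv ℝ ψ (t, x) (1, F t x w) i ≤ 0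

namespace IsControlLyapunov

lemma differentiableAt {E W ι : Type*} [NormedAddCommGroup E] [NormedSpace ℝ E] [Fintype ι] {T : ℝ}
    {F : ℝ → E → W → E} {ψ : ℝ × E → ι → ℝ} (hψ : IsControlLyapunov T F ψ)
    {t : ℝ} (ht : t ∈ Ioo 0 T) (x : E) :
    DifferentiableAt ℝ ψ (t, x) :=
  (hψ.contDiffOn.differentiableOn one_ne_zero).differentiableAt
    ((isOpen_Ioo.prod isOpen_univ).mem_nhds ⟨ht, mem_univ _⟩)

variable {E W ι : Type*} [NormedAddCommGroup E] [InnerProductSpace ℝ E] [FiniteDimensional ℝ E]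
  [PseudoMetricSpace W] [CompactSpace W] [Fintype ι] {T A : ℝ} {F : ℝ → E → W → E}
  {ψ : ℝ × E → ι → ℝ}

/-- A control that is good at a point is almost good near that point, locally uniformly. -/
lemma exists_uniform_control (hψ : IsControlLyapunov T F ψ) (hF : IsControlField T A F)
    {a b : ℝ} (ha : 0 < a) (hb : b < T) (R : ℝ) {ε : ℝ} (hε : 0 < ε) :
    ∃ η > 0, ∀ s ∈ Icc a b, ∀ y : E, ‖y‖ ≤ R → ∃ w, ∀ t ∈ Icc a b, ∀ z : E, ‖z‖ ≤ R →
      |t - s| < η → ‖z - y‖ < η → ∀ i, fderiv ℝ ψ (t, z) (1, F t z w) i ≤ ε := by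
  have hab : Icc a b ⊆ Ioo 0 T := fun t ht => ⟨ha.trans_le ht.1, ht.2.trans_lt hb⟩
  -- Including the compact control space in `K` makes `η` independent of the control, so one frozen
  -- `w` can be compared at two nearby points.
  set K : Set (ℝ × E × W) := Icc a b ×ˢ Metric.closedBall 0 R ×ˢ univ with hK
  have hKc : IsCompact K := isCompact_Icc.prod ((isCompact_closedBall 0 R).prod isCompact_univ)
  have hD : ContinuousOn (fun p : ℝ × E × W =>
      fderiv ℝ ψ (p.1, p.2.1) (1, F p.1 p.2.1 p.2.2)) K := by
    refine ContinuousOn.clm_apply ?_ (continuousOn_const.prodMk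
      (hF.continuousOn.mono fun p hp => ⟨Ioo_subset_Icc_self (hab hp.1), mem_univ _⟩))
    exact (hψ.contDiffOn.continuousOn_fderiv_of_isOpen (isOpen_Ioo.prod isOpen_univ) le_rfl).comp
      (f := fun p : ℝ × E × W => (p.1, p.2.1)) (by fun_prop)
      fun p hp => ⟨hab hp.1, mem_univ _⟩
  obtain ⟨η, hη, hunif⟩ := Metric.uniformContinuousOn_iff.1
    (hKc.uniformContinuousOn_of_continuous hD) ε hε
  refine ⟨η, hη, fun s hs y hy => ?_⟩
  obtain ⟨w, hw⟩ := hψ.exists_le s (hab hs) y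
  refine ⟨w, fun t ht z hz hts hzy i => ?_⟩
  have h1 := hunif (t, z, w) ⟨ht, by simpa using hz, mem_univ _⟩ (s, y, w)
    ⟨hs, by simpa using hy, mem_univ _⟩ (by
      rw [Prod.dist_eq, Prod.dist_eq]
      simp only [dist_self, dist_eq_norm]
      exact max_lt hts (max_lt hzy hη))
  have h2 := (dist_le_pi_dist _ _ i).trans_lt h1
  rw [Real.dist_eq] at h2
  linarith [le_abs_self (fderiv ℝ ψ (t, z) (1, F t z w) i - fderiv ℝ ψ (s, y) (1, F s y w) i),
    hw i]

variable [MeasurableSpace W]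

/-- Steering after the time `a`, one gets a trajectory along which `ψ` stays almost below its value
at `a` on `[a, b]`. -/
lemma exists_trajectory_Icc (hψ : IsControlLyapunov T F ψ) (hF : IsControlField T A F)
    {t₀ a b : ℝ} (ht₀ : t₀ ∈ Icc 0 T) (ht₀a : t₀ ≤ a) (ha : 0 < a) (hab : a ≤ b) (hb : b < T)
    (x₀ : E) (w₀ : W) {ε : ℝ} (hε : 0 < ε) :
    ∃ (w : ℝ → W) (x : ℝ → E), IsTrajectory T A F t₀ x₀ w x ∧
      ∀ t ∈ Icc a b, ∀ i, ψ (t, x t) i ≤ ψ (a, x a) i + ε * (t - a) := by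
  have hA := hF.A_nonneg
  set R := trajectoryRadius T A x₀ with hR
  have hR0 : 0 ≤ R := by rw [hR, trajectoryRadius]; positivity
  obtain ⟨η, hη, hctrl⟩ := hψ.exists_uniform_control hF ha hb R hε
  -- During one step of length `h` both time and state move by less than `η`.
  obtain ⟨h, hh, hhη, hMη⟩ : ∃ h > 0, h < η ∧ A * (1 + R) * h < η := by
    have hM : 0 ≤ A * (1 + R) := by positivity
    refine ⟨η / (A * (1 + R) + 2), by positivity, ?_, ?_⟩
    · exact div_lt_self hη (by linarith)
    · rw [mul_div_assoc', div_lt_iff₀ (by positivity)]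
      nlinarith
  -- Induction over the sampling times `a + k * h`, capped at `b`: each step appends a piece with
  -- the control chosen at the current state.
  set Good : ℝ → Prop := fun s => ∃ (w : ℝ → W) (x : ℝ → E), IsTrajectory T A F t₀ x₀ w x ∧
      ∀ t ∈ Icc a s, ∀ i, ψ (t, x t) i ≤ ψ (a, x a) i + ε * (t - a) with hGood
  have hstart : Good a := by
    obtain ⟨x, hx, -⟩ := hF.exists_trajectory_const ht₀ x₀ w₀
    refine ⟨_, x, hx, fun t ht i => ?_⟩
    rw [le_antisymm ht.2 ht.1]
    simp
  have hstep : ∀ s ∈ Icc a b, Good s → Good (min (s + h) b) := by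
    rintro s hs ⟨w, x, hx, hle⟩
    have hs₀ : s ∈ Icc t₀ T := ⟨ht₀a.trans hs.1, hs.2.trans hb.le⟩
    have hs₀' : s ∈ Icc 0 T := Icc_subset_Icc_left ht₀.1 hs₀
    obtain ⟨v, hv⟩ := hctrl s hs (x s) (hx.norm_le hA ht₀ hs₀')
    obtain ⟨z, hz, hz'⟩ := hF.exists_trajectory_const hs₀' (x s) v
    have hzs : z s = x s := hz.apply_start hs₀'
    have hc := hx.concat hz ht₀ hs₀
    refine ⟨_, _, hc, ?_⟩
    have hzeq : ∀ t, s ≤ t → (if t ≤ s then x t else z t) = z t := by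
      intro t ht
      rcases ht.eq_or_lt with rfl | h
      · rw [if_pos le_rfl, hzs]
      · rw [if_neg (not_le.2 h)]
    have hdec : ∀ t ∈ Icc s (min (s + h) b), ∀ i, ψ (t, z t) i ≤ ψ (s, x s) i + ε * (t - s) := by
      intro t ht i
      have hmem : ∀ τ ∈ Icc s (min (s + h) b), τ ∈ Icc a b := fun τ hτ =>
        ⟨hs.1.trans hτ.1, hτ.2.trans (min_le_right _ _)⟩
      have hder : ∀ τ ∈ Icc s (min (s + h) b), HasDerivAt (fun τ => ψ (τ, z τ) i)
          (fderiv ℝ ψ (τ, z τ) (1, F τ (z τ) v) i) τ := by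
        intro τ hτ
        have hτ' : τ ∈ Ioo 0 T :=
          ⟨ha.trans_le (hmem τ hτ).1, (hmem τ hτ).2.trans_lt hb⟩
        have h1 := (hz' τ (Ioo_subset_Icc_self hτ')).hasDerivAt (Icc_mem_nhds hτ'.1 hτ'.2)
        have h2 := ((hψ.differentiableAt hτ' (z τ)).hasFDerivAt).comp_hasDerivAt τ
          ((hasDerivAt_id τ).prodMk h1)
        exact (hasDerivAt_pi.1 h2) i
      have hbd : ∀ τ ∈ Icc s (min (s + h) b),
          fderiv ℝ ψ (τ, z τ) (1, F τ (z τ) v) i ≤ ε := by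
        intro τ hτ
        have hτT : τ ∈ Icc 0 T := ⟨ha.le.trans (hmem τ hτ).1, (hmem τ hτ).2.trans hb.le⟩
        have habs : |τ - s| ≤ h := by
          rw [abs_of_nonneg (sub_nonneg.2 hτ.1)]
          linarith [hτ.2.trans (min_le_left _ _)]
        -- The bounds come from the concatenation: it starts at `x₀` and so has radius `R`, whereas
        -- `z` alone would only get the radius attached to `x s`.
        have h1 := hc.norm_le hA ht₀ hτT
        have h2 := hc.norm_sub_le hA ht₀ hs₀' hτT
        rw [hzeq τ hτ.1] at h1 h2
        rw [if_pos le_rfl] at h2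
        refine hv τ (hmem τ hτ) (z τ) h1 (habs.trans_lt hhη) (h2.trans_lt (lt_of_le_of_lt ?_ hMη)) i
        gcongr
      have := (convex_Icc s (min (s + h) b)).image_sub_le_mul_sub_of_deriv_le
        (f := fun τ => ψ (τ, z τ) i) (C := ε)
        (fun τ hτ => (hder τ hτ).continuousAt.continuousWithinAt)
        (fun τ hτ => (hder τ (interior_subset hτ)).differentiableAt.differentiableWithinAt)
        (fun τ hτ => by
          rw [(hder τ (interior_subset hτ)).deriv]
          exact hbd τ (interior_subset hτ))
        s ⟨le_rfl, ht.1.trans ht.2⟩ t ht ht.1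
      rw [hzs] at this
      linarith
    intro t ht i
    rw [if_pos hs.1]
    rcases le_total t s with hts | hts
    · rw [if_pos hts]
      exact hle t ⟨ht.1, hts⟩ i
    · rw [hzeq t hts]
      have h1 := hdec t ⟨hts, ht.2⟩ i
      have h2 := hle s ⟨hs.1, le_rfl⟩ i
      linarith
  have hiter : ∀ k : ℕ, Good (min (a + k * h) b) := by
    intro k
    induction k with
    | zero => simpa [hab] using hstart
    | succ k ih =>
      have := hstep _ ⟨le_min (by linarith [mul_nonneg k.cast_nonneg hh.le]) hab,
        min_le_right _ _⟩ ih
      convert this using 1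
      push_cast
      rcases le_total (a + k * h) b with hk | hk
      · rw [min_eq_left hk]; ring_nf
      · rw [min_eq_right hk, min_eq_right (by linarith), min_eq_right (by linarith)]
  obtain ⟨N, hN⟩ := exists_nat_ge ((b - a) / h)
  have := hiter N
  rw [min_eq_right (by rw [div_le_iff₀ hh] at hN; linarith)] at this
  exact this

/-- Some trajectory keeps `ψ` almost below its initial value. -/
theorem exists_trajectory_le (hψ : IsControlLyapunov T F ψ) (hF : IsControlField T A F)
    {t₀ : ℝ} (ht₀ : t₀ ∈ Icc 0 T) (x₀ : E) (w₀ : W) {ε : ℝ} (hε : 0 < ε) :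
    ∃ (w : ℝ → W) (x : ℝ → E), IsTrajectory T A F t₀ x₀ w x ∧
      ∀ t ∈ Icc t₀ T, ∀ i, ψ (t, x t) i ≤ ψ (t₀, x₀) i + ε := by
  have hA := hF.A_nonneg
  have hT := hF.T_pos
  set R := trajectoryRadius T A x₀ with hR
  have hR0 : 0 ≤ R := by rw [hR, trajectoryRadius]; positivity
  obtain ⟨η, hη, hunif⟩ := Metric.uniformContinuousOn_iff.1
    ((isCompact_Icc.prod (isCompact_closedBall (0 : E) R)).uniformContinuousOn_of_continuous
      (hψ.continuousOn.mono (prod_mono_right (subset_univ _)))) (ε / 3) (by positivity)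
  have hM : 0 ≤ A * (1 + R) := by positivity
  -- Within time `δ` a trajectory moves too little to change `ψ` by `ε / 3`; `δ < T / 2` leaves room
  -- between `δ` and `T - δ`.
  obtain ⟨δ, hδ, hδη, hMη, hδT⟩ : ∃ δ > 0, δ < η ∧ A * (1 + R) * δ < η ∧ δ < T / 2 := by
    refine ⟨min (η / (A * (1 + R) + 2)) (T / 3), by positivity, ?_, ?_, ?_⟩
    · exact (min_le_left _ _).trans_lt (div_lt_self hη (by linarith))
    · refine (mul_le_mul_of_nonneg_left (min_le_left _ _) hM).trans_lt ?_
      rw [mul_div_assoc', div_lt_iff₀ (by positivity)]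
      nlinarith
    · exact (min_le_right _ _).trans_lt (by linarith)
  have hclose : ∀ {w x}, IsTrajectory T A F t₀ x₀ w x → ∀ s ∈ Icc t₀ T, ∀ t ∈ Icc t₀ T,
      |t - s| ≤ δ → ∀ i, ψ (t, x t) i ≤ ψ (s, x s) i + ε / 3 := by
    intro w x hx s hs t ht hts i
    replace hs := Icc_subset_Icc_left ht₀.1 hs
    replace ht := Icc_subset_Icc_left ht₀.1 ht
    have h1 := hunif (t, x t) ⟨ht, by simpa using hx.norm_le hA ht₀ ht⟩
      (s, x s) ⟨hs, by simpa using hx.norm_le hA ht₀ hs⟩ (by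
        rw [Prod.dist_eq, Real.dist_eq, dist_eq_norm]
        refine max_lt (hts.trans_lt hδη) (((hx.norm_sub_le hA ht₀ hs ht).trans ?_).trans_lt hMη)
        gcongr)
    have h2 := (dist_le_pi_dist _ _ i).trans_lt h1
    rw [Real.dist_eq] at h2
    linarith [le_abs_self (ψ (t, x t) i - ψ (s, x s) i)]
  -- Since `ψ` is `C¹` only for `0 < t < T`, steering takes place on `[max t₀ δ, T - δ]`. The
  -- initial piece, the steered piece and the final piece each cost at most `ε / 3`. If `t₀ > T -
  -- δ`, any trajectory will do.
  rcases le_or_gt t₀ (T - δ) with h0 | h0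
  · set a := max t₀ δ with ha
    set b := T - δ with hb
    have hta : t₀ ≤ a := le_max_left _ _
    have hab : a ≤ b := max_le h0 (by linarith)
    have hat : a - t₀ ≤ δ := by
      rcases max_cases t₀ δ with h | h <;> linarith [h.1, ht₀.1]
    obtain ⟨w, x, hx, hle⟩ := hψ.exists_trajectory_Icc hF ht₀ hta (hδ.trans_le (le_max_right _ _))
      hab (by linarith) x₀ w₀ (ε := ε / 3 / T) (by positivity)
    refine ⟨w, x, hx, fun t ht i => ?_⟩
    have hxt₀ : x t₀ = x₀ := hx.apply_start ht₀
    have haT : a ∈ Icc t₀ T := ⟨hta, by linarith⟩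
    have h1 := hclose hx t₀ ⟨le_rfl, ht₀.2⟩ a haT (by rwa [abs_of_nonneg (by linarith)]) i
    rw [hxt₀] at h1
    rcases le_or_gt t a with hta' | hta'
    · have h2 := hclose hx t₀ ⟨le_rfl, ht₀.2⟩ t ht
        (by rw [abs_of_nonneg (by linarith [ht.1])]; linarith) i
      rw [hxt₀] at h2
      linarith
    · have h3 : ∀ s ∈ Icc a b, ψ (s, x s) i ≤ ψ (a, x a) i + ε / 3 := by
        intro s hs
        refine (hle s hs i).trans ?_
        have : ε / 3 / T * (s - a) ≤ ε / 3 / T * T := by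
          gcongr
          linarith [hs.2, ht₀.1]
        rw [div_mul_cancel₀ _ hT.ne'] at this
        linarith
      rcases le_or_gt t b with htb | htb
      · linarith [h3 t ⟨hta'.le, htb⟩]
      · have h4 := hclose hx b ⟨hta.trans hab, by linarith⟩ t ht
          (by rw [abs_of_pos (by linarith)]; linarith [ht.2]) i
        linarith [h3 b ⟨hab, le_rfl⟩]
  · obtain ⟨x, hx, -⟩ := hF.exists_trajectory_const ht₀ x₀ w₀
    refine ⟨_, x, hx, fun t ht i => ?_⟩
    have h1 := hclose hx t₀ ⟨le_rfl, ht₀.2⟩ t ht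
      (by rw [abs_of_nonneg (by linarith [ht.1])]; linarith [ht.2]) i
    rw [hx.apply_start ht₀] at h1
    linarith

end IsControlLyapunov

/-! ### Passage to the limit by compactness -/

namespace IsControlLyapunov

variable {E W ι : Type*} [NormedAddCommGroup E] [InnerProductSpace ℝ E] [FiniteDimensional ℝ E]
  [PseudoMetricSpace W] [CompactSpace W] [Fintype ι] {T A : ℝ}
  {F : ℝ → E → W → E} {ψ : ℝ × E → ι → ℝ} [MeasurableSpace W]

/-- Some uniform limit of trajectories keeps `ψ` below its initial value. -/
theorem exists_mem_closure (hψ : IsControlLyapunov T F ψ) (hF : IsControlField T A F)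
    {t₀ : ℝ} (ht₀ : t₀ ∈ Icc 0 T) (x₀ : E) (w₀ : W) :
    ∃ y ∈ closure {x : C(Icc 0 T, E) | ∃ w : ℝ → W, Measurable w ∧ ∀ t : Icc 0 T,
        x t = x₀ + ∫ τ in t₀..t, F τ (IccExtend hF.T_pos.le x τ) (w τ)},
      ∀ t : Icc 0 T, t₀ ≤ t → ∀ i, ψ (t, y t) i ≤ ψ (t₀, x₀) i := by
  have hA := hF.A_nonneg
  set S : Set (BoundedContinuousFunction (Icc 0 T) E) :=
    {X | ∃ w x, IsTrajectory T A F t₀ x₀ w x ∧ ∀ t : Icc 0 T, X t = x t} with hS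
  -- All trajectories from `x₀` lie in one ball, compact by finite dimension, and share a Lipschitz
  -- constant.
  have hcomp : IsCompact (closure S) := by
    refine BoundedContinuousFunction.arzela_ascoli _
      (isCompact_closedBall (0 : E) (trajectoryRadius T A x₀)) S ?_ ?_
    · rintro X t ⟨w, x, hx, hX⟩
      rw [hX, mem_closedBall_zero_iff]
      exact hx.norm_le hA ht₀ t.2
    · have hlim : Filter.Tendsto (fun r : ℝ => A * (1 + trajectoryRadius T A x₀) * r)
          (nhds 0) (nhds 0) := by
        have : Continuous fun r : ℝ => A * (1 + trajectoryRadius T A x₀) * r := by fun_prop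
        simpa using this.tendsto 0
      refine (Metric.uniformEquicontinuous_of_continuity_modulus _ hlim _ ?_).equicontinuous
      rintro s t ⟨X, w, x, hx, hX⟩
      change dist (X s) (X t) ≤ _
      rw [hX, hX, dist_eq_norm, Subtype.dist_eq, Real.dist_eq]
      exact hx.norm_sub_le hA ht₀ t.2 s.2
  have happrox : ∀ k : ℕ, ∃ X ∈ S, ∀ t : Icc 0 T, t₀ ≤ t → ∀ i,
      ψ (t, X t) i ≤ ψ (t₀, x₀) i + 1 / ((k : ℝ) + 1) := by
    intro k
    obtain ⟨w, x, hx, hle⟩ := hψ.exists_trajectory_le hF ht₀ x₀ w₀ (ε := 1 / ((k : ℝ) + 1))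
      (by positivity)
    exact ⟨BoundedContinuousFunction.mkOfCompact ⟨_, hx.continuousOn.domRestrict⟩,
      ⟨w, x, hx, fun t => rfl⟩, fun t ht i => hle t ⟨ht, t.2.2⟩ i⟩
  choose X hXS hX using happrox
  obtain ⟨Y, -, θ, hθ, hlim⟩ := hcomp.tendsto_subseq fun k => subset_closure (hXS k)
  refine ⟨Y.toContinuousMap, ?_, fun t ht i => ?_⟩
  · have hcont : Continuous (BoundedContinuousFunction.toContinuousMap :
        BoundedContinuousFunction (Icc 0 T) E → C(Icc 0 T, E)) :=
      (ContinuousMap.isometryEquivBoundedOfCompact (Icc 0 T) E).symm.continuous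
    refine mem_closure_of_tendsto ((hcont.tendsto Y).comp hlim)
      (Filter.Eventually.of_forall fun k => ?_)
    obtain ⟨w, x, hx, hXx⟩ := hXS (θ k)
    refine ⟨w, hx.measurable, fun t => ?_⟩
    refine (hXx t).trans ((hx.eq_integral t t.2).trans ?_)
    congr 1
    refine intervalIntegral.integral_congr fun τ hτ => ?_
    have hτ' : τ ∈ Icc 0 T := uIcc_subset_Icc ht₀ t.2 hτ
    rw [IccExtend_of_mem _ _ hτ']
    exact congrArg (fun y => F τ y (w τ)) (hXx ⟨τ, hτ'⟩).symm
  · have h1 : Filter.Tendsto (fun k => X (θ k) t) Filter.atTop (nhds (Y t)) :=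
      ((ContinuousEvalConst.continuous_eval_const t).tendsto Y).comp hlim
    have h2 : Filter.Tendsto (fun k => ψ (t, X (θ k) t)) Filter.atTop (nhds (ψ (t, Y t))) := by
      refine ((hψ.continuousOn (t, Y t) ⟨t.2, mem_univ _⟩).tendsto).comp
        (tendsto_nhdsWithin_iff.2 ⟨tendsto_const_nhds.prodMk_nhds h1,
          Filter.Eventually.of_forall fun k => ⟨t.2, mem_univ _⟩⟩)
    have h3 : Filter.Tendsto (fun k => ψ (t₀, x₀) i + 1 / ((θ k : ℝ) + 1)) Filter.atTop
        (nhds (ψ (t₀, x₀) i + 0)) :=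
      tendsto_const_nhds.add (tendsto_one_div_add_atTop_nhds_zero_nat.comp hθ.tendsto_atTop)
    rw [add_zero] at h3
    exact le_of_tendsto_of_tendsto' ((tendsto_pi_nhds.1 h2) i) h3 fun k => hX (θ k) t ht i

end IsControlLyapunov

/-! ### Application to the game -/

namespace DiffGame

variable {n : ℕ} {P Q : Type*} [TopologicalSpace P] [TopologicalSpace Q]

lemma exists_growth_const (G : DiffGame n P Q) : ∃ A : ℝ, 0 ≤ A ∧
    (∀ t ∈ Icc 0 G.T, ∀ (x : Phase n) (u : P), ‖G.f t x u‖ ≤ A * (1 + ‖x‖)) ∧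
    ∀ t ∈ Icc 0 G.T, ∀ (x : Phase n) (v : Q), ‖G.g t x v‖ ≤ A * (1 + ‖x‖) := by
  obtain ⟨A, hA⟩ := G.growth_f
  obtain ⟨B, hB⟩ := G.growth_g
  refine ⟨max 0 (max A B), le_max_left _ _, fun t ht x u => (hA t ht x u).trans ?_,
    fun t ht x v => (hB t ht x v).trans ?_⟩
  · gcongr
    exact (le_max_left A B).trans (le_max_right _ _)
  · gcongr
    exact (le_max_right A B).trans (le_max_right _ _)

/-- The dynamics of a differential game, when the controls of the two players depend continuously
on a common control parameter. -/
theorem exists_isControlField (G : DiffGame n P Q) {W : Type*} [TopologicalSpace W] {p : W → P}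
    {q : W → Q} (hp : Continuous p) (hq : Continuous q) :
    ∃ A, IsControlField G.T A fun t x w => G.f t x (p w) + G.g t x (q w) := by
  obtain ⟨A, hA0, hf, hg⟩ := G.exists_growth_const
  refine ⟨A + A, G.T_pos, by positivity, ?_, fun R => ?_, fun t ht x w => ?_⟩
  · exact (G.continuousOn_f.comp (f := fun z : ℝ × Phase n × W => (z.1, z.2.1, p z.2.2))
      (by fun_prop) fun z hz => ⟨hz.1, mem_univ _⟩).add
      (G.continuousOn_g.comp (f := fun z : ℝ × Phase n × W => (z.1, z.2.1, q z.2.2))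
      (by fun_prop) fun z hz => ⟨hz.1, mem_univ _⟩)
  · obtain ⟨L, hL⟩ := G.lipschitz_f R
    obtain ⟨L', hL'⟩ := G.lipschitz_g R
    refine ⟨L + L', fun t ht x y hx hy w => ?_⟩
    rw [add_sub_add_comm, add_mul]
    exact norm_add_le_of_le (hL t ht x y hx hy _) (hL' t ht x y hx hy _)
  · rw [add_mul]
    exact norm_add_le_of_le (hf t ht x _) (hg t ht x _)

end DiffGame

/-- The derivative of a function of time and state, in terms of its partial derivatives. -/
lemma fderiv_prod_apply_one {E : Type*} [NormedAddCommGroup E] [InnerProductSpace ℝ E]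
    [CompleteSpace E] {φ : ℝ → E → ℝ} {t : ℝ} {x : E}
    (h : DifferentiableAt ℝ (fun z : ℝ × E => φ z.1 z.2) (t, x)) (v : E) :
    fderiv ℝ (fun z : ℝ × E => φ z.1 z.2) (t, x) (1, v) =
      deriv (fun s => φ s x) t + inner ℝ (gradient (φ t) x) v := by
  have h1 : HasDerivAt (fun s => φ s x)
      (fderiv ℝ (fun z : ℝ × E => φ z.1 z.2) (t, x) (1, 0)) t :=
    h.hasFDerivAt.comp_hasDerivAt (f := fun s => (s, x)) t
      ((hasDerivAt_id t).prodMk (hasDerivAt_const t x))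
  have h2 : HasFDerivAt (φ t) ((fderiv ℝ (fun z : ℝ × E => φ z.1 z.2) (t, x)).comp
      (ContinuousLinearMap.inr ℝ ℝ E)) x :=
    h.hasFDerivAt.comp (f := fun y => (t, y)) x (hasFDerivAt_prodMk_right t x)
  have h3 : inner ℝ (gradient (φ t) x) v = fderiv ℝ (φ t) x v := by
    rw [gradient, InnerProductSpace.toDual_symm_apply]
  rw [h1.deriv, h3, h2.fderiv, ContinuousLinearMap.comp_apply, ContinuousLinearMap.inr_apply,
    ← map_add]
  simp

/-- A family of functions, each `C¹` inside, that decreases in the direction of suitable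
controls. -/
lemma isControlLyapunov_of_partial {E W ι : Type*} [NormedAddCommGroup E] [InnerProductSpace ℝ E]
    [CompleteSpace E] [Fintype ι] {T : ℝ} {F : ℝ → E → W → E} {φ : ι → ℝ → E → ℝ}
    (hc : ∀ i, ContinuousOn (fun z : ℝ × E => φ i z.1 z.2) (Icc 0 T ×ˢ univ))
    (hd : ∀ i, ContDiffOn ℝ 1 (fun z : ℝ × E => φ i z.1 z.2) (Ioo 0 T ×ˢ univ))
    (h : ∀ t ∈ Ioo 0 T, ∀ x, ∃ w, ∀ i,
      deriv (fun s => φ i s x) t + inner ℝ (gradient (φ i t) x) (F t x w) ≤ 0) :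
    IsControlLyapunov T F fun z i => φ i z.1 z.2 := by
  refine ⟨continuousOn_pi.2 hc, contDiffOn_pi.2 hd, fun t ht x => ?_⟩
  obtain ⟨w, hw⟩ := h t ht x
  have hdiff : ∀ i, DifferentiableAt ℝ (fun z : ℝ × E => φ i z.1 z.2) (t, x) := fun i =>
    ((hd i).differentiableOn one_ne_zero).differentiableAt
      ((isOpen_Ioo.prod isOpen_univ).mem_nhds ⟨ht, mem_univ _⟩)
  refine ⟨w, fun i => ?_⟩
  rw [fderiv_pi hdiff, ContinuousLinearMap.pi_apply, fderiv_prod_apply_one (hdiff i)]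
  exact hw i

/-- Lets `-φ` join the family `ψ`, so that equality in (F4) becomes two inequalities. -/
lemma deriv_neg_add_inner_gradient_neg {E : Type*} [NormedAddCommGroup E] [InnerProductSpace ℝ E]
    [CompleteSpace E] (φ : ℝ → E → ℝ) (t : ℝ) (x v : E) :
    deriv (fun s => -φ s x) t + inner ℝ (gradient (fun y => -φ t y) x) v =
      -(deriv (fun s => φ s x) t + inner ℝ (gradient (φ t) x) v) := by
  rw [deriv.fun_neg, gradient, gradient, fderiv_fun_neg, map_neg, inner_neg_left]
  ring

theorem mainTheorem7 {n : ℕ} {P Q : Type*}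
    [MetricSpace P] [CompactSpace P] [MeasurableSpace P] [BorelSpace P]
    [MetricSpace Q] [CompactSpace Q] [MeasurableSpace Q] [BorelSpace Q]
    (G : DiffGame n P Q)
    (uhat : ℝ → Phase n → Phase n → P) (vhat : ℝ → Phase n → Phase n → Q)
    (huhat : G.IsMaximizer₁ uhat) (hvhat : G.IsMaximizer₂ vhat)
    (φ₁ φ₂ : ℝ → Phase n → ℝ) (hφ : G.IsClassicalSolution uhat vhat φ₁ φ₂) :
    G.IsValueFunction φ₁ φ₂ := by
  refine ⟨hφ.continuousOn₁, hφ.continuousOn₂, fun x => ⟨hφ.terminal₁ x, hφ.terminal₂ x⟩, ?_, ?_, ?_⟩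
  · intro t₀ ht₀ x₀ u
    obtain ⟨A, hF⟩ := G.exists_isControlField (W := Q) (p := fun _ => u) (q := id)
      continuous_const continuous_id
    have hψ : IsControlLyapunov G.T (fun t x v => G.f t x u + G.g t x v)
        (fun z (_ : Unit) => φ₁ z.1 z.2) := by
      refine isControlLyapunov_of_partial (φ := fun _ => φ₁) (fun _ => hφ.continuousOn₁)
        (fun _ => hφ.contDiffOn₁) fun t ht x => ⟨vhat t x (gradient (φ₂ t) x), fun _ => ?_⟩
      have h1 := hφ.equation₁ t ht x
      -- Replacing `û` by the given `u` can only lower `⟨∇φ₁, f⟩`, so the equation becomes an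
      -- inequality.
      have h2 := huhat t (Ioo_subset_Icc_self ht) x (gradient (φ₁ t) x) u
      rw [DiffGame.Ham₁, inner_add_right] at h1
      rw [inner_add_right]
      linarith
    -- `vhat 0 0 0` serves only as some element of `Q`: a control for the times when no steering is
    -- done.
    obtain ⟨y, hy, hle⟩ := hψ.exists_mem_closure hF ht₀ x₀ (vhat 0 0 0)
    exact ⟨y, hy, fun t ht => hle t ht ()⟩
  · intro t₀ ht₀ x₀ v
    obtain ⟨A, hF⟩ := G.exists_isControlField (W := P) (p := id) (q := fun _ => v)
      continuous_id continuous_const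
    have hψ : IsControlLyapunov G.T (fun t x u => G.f t x u + G.g t x v)
        (fun z (_ : Unit) => φ₂ z.1 z.2) := by
      refine isControlLyapunov_of_partial (φ := fun _ => φ₂) (fun _ => hφ.continuousOn₂)
        (fun _ => hφ.contDiffOn₂) fun t ht x => ⟨uhat t x (gradient (φ₁ t) x), fun _ => ?_⟩
      have h1 := hφ.equation₂ t ht x
      have h2 := hvhat t (Ioo_subset_Icc_self ht) x (gradient (φ₂ t) x) v
      rw [DiffGame.Ham₂, inner_add_right] at h1
      rw [inner_add_right]
      linarith
    obtain ⟨y, hy, hle⟩ := hψ.exists_mem_closure hF ht₀ x₀ (uhat 0 0 0)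
    exact ⟨y, hy, fun t ht => hle t ht ()⟩
  · intro t₀ ht₀ x₀
    obtain ⟨A, hF⟩ := G.exists_isControlField (W := P × Q) continuous_fst continuous_snd
    have hψ : IsControlLyapunov G.T (fun t x (w : P × Q) => G.f t x w.1 + G.g t x w.2)
        -- A single limit trajectory serves all components at once, so `φ₁` and `φ₂` are constant
        -- along the same motion.
        (fun z i => ![φ₁, fun t x => -φ₁ t x, φ₂, fun t x => -φ₂ t x] i z.1 z.2) := by
      refine isControlLyapunov_of_partial ?_ ?_ fun t ht x =>
        ⟨(uhat t x (gradient (φ₁ t) x), vhat t x (gradient (φ₂ t) x)), ?_⟩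
      · simpa [Fin.forall_fin_succ] using
          ⟨hφ.continuousOn₁, hφ.continuousOn₁.neg, hφ.continuousOn₂, hφ.continuousOn₂.neg⟩
      · simpa [Fin.forall_fin_succ] using
          ⟨hφ.contDiffOn₁, hφ.contDiffOn₁.neg, hφ.contDiffOn₂, hφ.contDiffOn₂.neg⟩
      · have h1 := hφ.equation₁ t ht x
        have h2 := hφ.equation₂ t ht x
        rw [DiffGame.Ham₁] at h1
        rw [DiffGame.Ham₂] at h2
        have h3 := deriv_neg_add_inner_gradient_neg φ₁ t x
        have h4 := deriv_neg_add_inner_gradient_neg φ₂ t x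
        intro i
        fin_cases i
        · exact h1.le
        · exact ((h3 _).trans (by rw [h1, neg_zero])).le
        · exact h2.le
        · exact ((h4 _).trans (by rw [h2, neg_zero])).le
    obtain ⟨y, hy, hle⟩ := hψ.exists_mem_closure hF ht₀ x₀ (uhat 0 0 0, vhat 0 0 0)
    refine ⟨y, closure_mono ?_ hy, fun t ht => ⟨le_antisymm (hle t ht 0) ?_,
      le_antisymm (hle t ht 2) ?_⟩⟩
    · rintro x ⟨w, hw, hx⟩
      exact ⟨fun τ => (w τ).1, fun τ => (w τ).2, measurable_fst.comp hw, measurable_snd.comp hw, hx⟩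
    · exact neg_le_neg_iff.1 (hle t ht 1)
    · exact neg_le_neg_iff.1 (hle t ht 3)
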